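/- Fix a positive integer $m$ and a constant $0<\beta<1$. For each $n$, let $h_{-m+2},\dots,h_n$ be i.i.d. $N(0,1)$ random variables and let $H=H_n\in\mathbb R^{n\times m}$ be the Gaussian (Toeplitz-structured) matrix $$H=\begin{bmatrix} h_{-m+2} & h_{-m+3} & \cdots & h_1\\ h_{-m+3} & h_{-m+4} & \cdots & h_2\\ \vdots & \vdots & & \vdots\\ h_{-m+n+1} & h_{-m+n+2} & \cdots & h_n\end{bmatrix}.$$ For each $n$ let $e=e_n\in\mathbb R^n$ be a fixed (deterministic) vector, with arbitrary support and arbitrary values, having at most $\beta n$ nonzero entries. Then, with probability tending to $1$ as $n\to\infty$, the following holds: for every $x\in\mathbb R^m$, with $y=Hx+e$, the vector $x$ is the unique solution of the $\ell_1$ minimization problem $\min_{x'\in\mathbb R^m}\|y-Hx'\|_1$. In particular, when the error vector is fixed and recovery is not required simultaneously for all supports, every fraction $\beta<1$ of errors is correctable. -/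

import Mathlib

open MeasureTheory ProbabilityTheory Filter Topology

/-- The `n × m` matrix with constant skew-diagonals
`[h_{-m+2}, h_{-m+3}, …, h_1; h_{-m+3}, h_{-m+4}, …, h_2; …; h_{-m+n+1}, …, h_n]`
built from the input sequence `h`. With zero-based indices, the entry in row `i` and column `j`
is `h_{-m+2+i+j}`, so that precisely the terms `h_{-m+2}, …, h_n` occur. -/
def toeplitzMatrix (n m : ℕ) (h : ℤ → ℝ) : Matrix (Fin n) (Fin m) ℝ :=
  Matrix.of fun i j => h (-(m : ℤ) + 2 + ((i : ℕ) : ℤ) + ((j : ℕ) : ℤ))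

/-- The `ℓ₁` norm of a vector in `ℝⁿ`. -/
def l1Norm {n : ℕ} (v : Fin n → ℝ) : ℝ := ∑ i, |v i|

/-- The number of nonzero entries of a vector. -/
noncomputable def numNonzero {n : ℕ} (v : Fin n → ℝ) : ℕ := (Function.support v).ncard

/-- `x` is the unique solution of the `ℓ₁` minimization problem `min_{x'} ‖y - H x'‖₁`. -/
def IsUniqueL1Minimizer {n m : ℕ} (H : Matrix (Fin n) (Fin m) ℝ) (y : Fin n → ℝ)
    (x : Fin m → ℝ) : Prop :=
  ∀ x' : Fin m → ℝ, x' ≠ x → l1Norm (y - H.mulVec x) < l1Norm (y - H.mulVec x')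

/-! Put `z = x' - x` and `a = Hz`. Convexity of the absolute value gives `‖e - a‖₁ - ‖e‖₁ ≥ ∑_{e i =
0} |a i| - ∑ sign(e i) a i`. Since the signs are fixed, the last sum is typically of order `√n
‖z‖₁`, while the first is nearly of order `n ‖z‖₁`: the Gram matrix of the at least `(1-β)n` clean
rows is close to a multiple of the identity, and a bound on the entries of `H` turns this `ℓ₂`
estimate into an `ℓ₁` one. Only finitely many random quantities (signed column sums, Gram entries,
matrix entries) must be controlled, so the conclusion is uniform in `z`. Moment bounds and a union
bound suffice, since Gram summands of different rows are uncorrelated despite sharing variables. -/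

/-! ### Deterministic recovery criterion -/

/-- Deterministic sufficient condition for `ℓ₁` recovery: the error signs are nearly orthogonal to
the columns of `H`, the entries are bounded, and the rows outside the error support have nearly
isotropic Gram matrix. -/
lemma isUniqueL1Minimizer_of_gram {n m : ℕ} (H : Matrix (Fin n) (Fin m) ℝ) (e : Fin n → ℝ)
    {N B δ : ℝ} (hB : 0 < B)
    (hN : ∀ j, |∑ i, (SignType.sign (e i) : ℝ) * H i j| ≤ N)
    (hH : ∀ i j, |H i j| ≤ B)
    (hG : ∀ j k, |∑ i with e i = 0, (H i j * H i k - if j = k then 1 else 0)| ≤ δ)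
    (hlt : m * B * N + m * δ < (Finset.univ.filter fun i => e i = 0).card) (x : Fin m → ℝ) :
    IsUniqueL1Minimizer H (H.mulVec x + e) x := by
  intro x' hx'
  set z := x' - x with hz
  have hz0 : z ≠ 0 := sub_ne_zero.2 hx'
  have e1 : H.mulVec x + e - H.mulVec x = e := by abel
  have e2 : H.mulVec x + e - H.mulVec x' = e - H.mulVec z := by
    rw [hz, Matrix.mulVec_sub]; abel
  rw [e1, e2]
  set a := H.mulVec z with ha
  have haz : ∀ i, a i = ∑ j, H i j * z j := fun i => rfl
  set Z := ∑ j, |z j| with hZ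
  set D : ℝ := ((Finset.univ.filter fun i => e i = 0).card : ℝ) with hD
  have hZ0 : 0 < Z := by
    obtain ⟨j, hj⟩ := Function.ne_iff.1 hz0
    exact Finset.sum_pos' (fun _ _ => abs_nonneg _) ⟨j, Finset.mem_univ _, abs_pos.2 hj⟩
  have hm0 : (0 : ℝ) < m := by
    obtain ⟨j, hj⟩ := Function.ne_iff.1 hz0
    exact_mod_cast j.pos
  have hD0 : 0 ≤ D := by positivity
  have haB : ∀ i, |a i| ≤ B * Z := by
    intro i
    rw [haz, hZ, Finset.mul_sum]
    refine (Finset.abs_sum_le_sum_abs _ _).trans (Finset.sum_le_sum fun j _ => ?_)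
    rw [abs_mul]
    exact mul_le_mul_of_nonneg_right (hH i j) (abs_nonneg _)
  have hnoise : ∑ i, (SignType.sign (e i) : ℝ) * a i ≤ N * Z := by
    have : ∑ i, (SignType.sign (e i) : ℝ) * a i
        = ∑ j, (∑ i, (SignType.sign (e i) : ℝ) * H i j) * z j := by
      simp_rw [haz, Finset.mul_sum, Finset.sum_mul]
      rw [Finset.sum_comm]
      simp_rw [mul_assoc]
    rw [this, hZ, Finset.mul_sum]
    refine Finset.sum_le_sum fun j _ => (le_abs_self _).trans ?_
    rw [abs_mul]
    exact mul_le_mul_of_nonneg_right (hN j) (abs_nonneg _)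
  have hCS : Z ^ 2 ≤ m * ∑ j, z j ^ 2 := by
    have := sq_sum_le_card_mul_sum_sq (s := (Finset.univ : Finset (Fin m))) (f := fun j => |z j|)
    simpa using this
  have hquad : D * ∑ j, z j ^ 2 - δ * Z ^ 2 ≤ ∑ i with e i = 0, a i ^ 2 := by
    have key : ∑ i with e i = 0, a i ^ 2 - D * ∑ j, z j ^ 2
        = ∑ j, ∑ k, (∑ i with e i = 0, (H i j * H i k - if j = k then 1 else 0))
            * (z j * z k) := by
      have h1 : ∑ i with e i = 0, a i ^ 2
          = ∑ j, ∑ k, (∑ i with e i = 0, H i j * H i k) * (z j * z k) := by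
        simp_rw [haz, sq, Finset.sum_mul_sum, Finset.sum_mul]
        rw [Finset.sum_comm]
        refine Finset.sum_congr rfl fun j _ => ?_
        rw [Finset.sum_comm]
        exact Finset.sum_congr rfl fun k _ => Finset.sum_congr rfl fun i _ => by ring
      rw [h1]
      simp_rw [Finset.sum_sub_distrib, sub_mul, Finset.sum_sub_distrib]
      congr 1
      simp [← hD, Finset.mul_sum, sq]
    have hb : |∑ j, ∑ k, (∑ i with e i = 0, (H i j * H i k - if j = k then 1 else 0))
            * (z j * z k)| ≤ δ * Z ^ 2 := by
      rw [sq, hZ, Finset.sum_mul_sum, Finset.mul_sum]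
      refine (Finset.abs_sum_le_sum_abs _ _).trans (Finset.sum_le_sum fun j _ => ?_)
      rw [Finset.mul_sum]
      refine (Finset.abs_sum_le_sum_abs _ _).trans (Finset.sum_le_sum fun k _ => ?_)
      rw [abs_mul, abs_mul]
      exact mul_le_mul_of_nonneg_right (hG j k) (by positivity)
    rw [← key] at hb
    linarith [(abs_le.1 hb).1]
  set W := ∑ i with e i = 0, |a i| with hW
  -- The sup bound `|a i| ≤ B * Z` gives `ℓ₂² ≤ ℓ∞ · ℓ₁` on the clean rows, hence a lower bound for
  -- `W`.
  have hsq : ∑ i with e i = 0, a i ^ 2 ≤ B * Z * W := by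
    rw [hW, Finset.mul_sum]
    refine Finset.sum_le_sum fun i _ => ?_
    rw [← sq_abs, sq]
    exact mul_le_mul_of_nonneg_right (haB i) (abs_nonneg _)
  have hfin : N * Z < W := by
    have h1 : (m * B * N + m * δ) * Z ^ 2 < D * Z ^ 2 :=
      mul_lt_mul_of_pos_right hlt (by positivity)
    have h2 : D * Z ^ 2 ≤ D * (m * ∑ j, z j ^ 2) := mul_le_mul_of_nonneg_left hCS hD0
    have h3 : m * (D * ∑ j, z j ^ 2 - δ * Z ^ 2) ≤ m * (B * Z * W) :=
      mul_le_mul_of_nonneg_left (hquad.trans hsq) hm0.le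
    have h4 : m * B * Z * (N * Z) < m * B * Z * W := by nlinarith
    exact lt_of_mul_lt_mul_left h4 (by positivity)
  -- Subgradient inequality for the absolute value; where `e i = 0` it is the equality `|0 - a i| =
  -- |a i|`.
  have hpt : ∀ i, |e i| - (SignType.sign (e i) : ℝ) * a i + (if e i = 0 then |a i| else 0)
      ≤ |e i - a i| := by
    intro i
    rcases lt_trichotomy (e i) 0 with h | h | h
    · simp only [sign_neg h, h.ne, abs_of_neg h, if_false, SignType.coe_neg_one]
      linarith [neg_abs_le (e i - a i)]
    · simp [h]
    · simp only [sign_pos h, h.ne', abs_of_pos h, if_false, SignType.coe_one]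
      linarith [le_abs_self (e i - a i)]
  have hsum := Finset.sum_le_sum fun i (_ : i ∈ Finset.univ) => hpt i
  rw [Finset.sum_add_distrib, Finset.sum_sub_distrib, ← Finset.sum_filter] at hsum
  simp only [l1Norm, Pi.sub_apply]
  linarith

/-! ### Moments and tail bounds -/

section Tail

variable {Ω : Type*} [MeasurableSpace Ω] {P : Measure Ω}

/-- Chebyshev's inequality for a sum of pairwise orthogonal square-integrable variables. -/
lemma measureReal_le_abs_sum_le {ι : Type*} (s : Finset ι) (X : ι → Ω → ℝ) {C t : ℝ} (ht : 0 < t)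
    (hL : ∀ i ∈ s, MemLp (X i) 2 P)
    (horth : ∀ i ∈ s, ∀ j ∈ s, i ≠ j → ∫ ω, X i ω * X j ω ∂P = 0)
    (hC : ∀ i ∈ s, ∫ ω, X i ω ^ 2 ∂P ≤ C) :
    P.real {ω | t ≤ |∑ i ∈ s, X i ω|} ≤ s.card * C / t ^ 2 := by
  have hint : ∀ i ∈ s, ∀ j ∈ s, Integrable (fun ω => X i ω * X j ω) P :=
    fun i hi j hj => (hL i hi).integrable_mul (hL j hj)
  have hexp : ∫ ω, (∑ i ∈ s, X i ω) ^ 2 ∂P ≤ s.card * C := by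
    simp_rw [sq, Finset.sum_mul_sum]
    rw [integral_finsetSum _ fun i hi => integrable_finsetSum _ fun j hj => hint i hi j hj]
    rw [← nsmul_eq_mul]
    refine Finset.sum_le_card_nsmul _ _ _ fun i hi => ?_
    rw [integral_finsetSum _ fun j hj => hint i hi j hj,
      Finset.sum_eq_single_of_mem i hi fun j hj hji => horth i hi j hj hji.symm]
    simpa [sq] using hC i hi
  have hI : Integrable (fun ω => (∑ i ∈ s, X i ω) ^ 2) P := by
    simp_rw [sq, Finset.sum_mul_sum]
    exact integrable_finsetSum _ fun i hi => integrable_finsetSum _ fun j hj => hint i hi j hj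
  have hM := mul_meas_ge_le_integral_of_nonneg (μ := P) (f := fun ω => (∑ i ∈ s, X i ω) ^ 2)
    (.of_forall fun ω => sq_nonneg _) hI (t ^ 2)
  have hset : {ω | t ^ 2 ≤ (∑ i ∈ s, X i ω) ^ 2} = {ω | t ≤ |∑ i ∈ s, X i ω|} := by
    ext ω
    simp only [Set.mem_ofPred_eq]
    rw [← sq_abs (∑ i ∈ s, X i ω), pow_le_pow_iff_left₀ ht.le (abs_nonneg _) two_ne_zero]
  rw [hset] at hM
  rw [le_div_iff₀ (by positivity), mul_comm]
  exact hM.trans hexp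

variable {κ : Type*} {g : κ → Ω → ℝ}

lemma memLp_of_hasLaw_gaussianReal {X : Ω → ℝ} (hX : HasLaw X (gaussianReal 0 1) P)
    (p : NNReal) : MemLp X p P := by
  have h := memLp_id_gaussianReal (μ := 0) (v := 1) p
  rw [← hX.map_eq] at h
  exact (memLp_map_measure_iff h.1 hX.aemeasurable).1 h

lemma memLp_mul_of_hasLaw_gaussianReal {X Y : Ω → ℝ} (hX : HasLaw X (gaussianReal 0 1) P)
    (hY : HasLaw Y (gaussianReal 0 1) P) : MemLp (fun ω => X ω * Y ω) 2 P := by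
  have : ENNReal.HolderTriple ((4 : NNReal) : ENNReal) ((4 : NNReal) : ENNReal) 2 := by
    constructor
    have h4 : ((4 : NNReal) : ENNReal) = 2 * 2 := by norm_num
    rw [h4, ENNReal.mul_inv (by simp) (by simp), ← mul_add, ENNReal.inv_two_add_inv_two, mul_one]
  exact (memLp_of_hasLaw_gaussianReal hY 4).mul' (memLp_of_hasLaw_gaussianReal hX 4)

lemma integral_eq_zero_of_hasLaw_gaussianReal {X : Ω → ℝ} (hX : HasLaw X (gaussianReal 0 1) P) :
    ∫ ω, X ω ∂P = 0 := by
  rw [hX.integral_eq, integral_id_gaussianReal]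

lemma integral_sq_of_hasLaw_gaussianReal {X : Ω → ℝ} (hX : HasLaw X (gaussianReal 0 1) P) :
    ∫ ω, X ω ^ 2 ∂P = 1 := by
  have h := hX.variance_eq
  have h0 := integral_eq_zero_of_hasLaw_gaussianReal hX
  rw [variance_of_integral_eq_zero hX.aemeasurable h0] at h
  simpa [variance_id_gaussianReal] using h

lemma integral_pow_of_hasLaw_gaussianReal {X : Ω → ℝ} (hX : HasLaw X (gaussianReal 0 1) P)
    (k : ℕ) : ∫ ω, X ω ^ k ∂P = ∫ x, x ^ k ∂gaussianReal 0 1 :=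
  hX.integral_comp (f := fun x : ℝ => x ^ k) (by fun_prop)

lemma integrable_pow_of_hasLaw_gaussianReal [IsProbabilityMeasure P]
    {X : Ω → ℝ} (hX : HasLaw X (gaussianReal 0 1) P)
    (k : ℕ) : Integrable (fun ω => X ω ^ k) P :=
  (integrable_norm_iff (hX.aemeasurable.pow_const k).aestronglyMeasurable).1 <| by
    simpa only [norm_pow] using (memLp_of_hasLaw_gaussianReal hX k).integrable_norm_pow'

lemma integral_mul_sub_sq_le [IsProbabilityMeasure P]
    {X Y : Ω → ℝ} (hX : HasLaw X (gaussianReal 0 1) P)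
    (hY : HasLaw Y (gaussianReal 0 1) P) {c : ℝ} (hc : c ^ 2 ≤ 1) :
    ∫ ω, (X ω * Y ω - c) ^ 2 ∂P ≤ 2 * (∫ x, x ^ 4 ∂gaussianReal 0 1) + 2 := by
  have hIX := integrable_pow_of_hasLaw_gaussianReal hX 4
  have hIY := integrable_pow_of_hasLaw_gaussianReal hY 4
  have hle : ∫ ω, (X ω * Y ω - c) ^ 2 ∂P ≤ ∫ ω, (X ω ^ 4 + Y ω ^ 4 + 2) ∂P := by
    refine integral_mono (((memLp_mul_of_hasLaw_gaussianReal hX hY).sub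
      (memLp_const c)).integrable_sq) ((hIX.add hIY).add (integrable_const 2)) fun ω => ?_
    dsimp only
    -- `(XY - c)² ≤ 2X²Y² + 2c² ≤ X⁴ + Y⁴ + 2`.
    nlinarith [sq_nonneg (X ω * Y ω + c), sq_nonneg (X ω ^ 2 - Y ω ^ 2)]
  refine hle.trans_eq ?_
  have hI : Integrable (fun ω => X ω ^ 4 + Y ω ^ 4) P := hIX.add hIY
  rw [integral_add hI (integrable_const 2), integral_add hIX hIY,
    integral_pow_of_hasLaw_gaussianReal hX, integral_pow_of_hasLaw_gaussianReal hY]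
  simp
  ring

/-- The centered factor `g p` is independent of the other three, which may coincide among
themselves. -/
lemma integral_mul_mul_eq_zero (hind : iIndepFun g P)
    (hlaw : ∀ a, HasLaw (g a) (gaussianReal 0 1) P) {p q r s : κ}
    (hq : p ≠ q) (hr : p ≠ r) (hs : p ≠ s) :
    ∫ ω, (g p ω * g q ω) * (g r ω * g s ω) ∂P = 0 := by
  classical
  have hm : ∀ a, AEMeasurable (g a) P := fun a => (hlaw a).aemeasurable
  have hI := hind.indepFun_finset₀ {p} {q, r, s} (by simp [hq, hr, hs]) hm
  have hI2 : IndepFun (g p) (fun ω => g q ω * (g r ω * g s ω)) P :=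
    hI.comp (φ := fun v : ({p} : Finset κ) → ℝ => v ⟨p, by simp⟩)
      (ψ := fun v : ({q, r, s} : Finset κ) → ℝ =>
        v ⟨q, by simp⟩ * (v ⟨r, by simp⟩ * v ⟨s, by simp⟩))
      (by fun_prop) (by fun_prop)
  have h := hI2.integral_fun_mul_eq_mul_integral (hm p).aestronglyMeasurable
    ((hm q).mul ((hm r).mul (hm s))).aestronglyMeasurable
  rw [integral_eq_zero_of_hasLaw_gaussianReal (hlaw p), zero_mul] at h
  rw [← h]
  exact integral_congr_ae (.of_forall fun ω => by ring)

lemma integral_mul_eq_zero (hind : iIndepFun g P)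
    (hlaw : ∀ a, HasLaw (g a) (gaussianReal 0 1) P) {p q : κ} (hq : p ≠ q) :
    ∫ ω, g p ω * g q ω ∂P = 0 := by
  have h := (hind.indepFun hq).integral_fun_mul_eq_mul_integral
    (hlaw p).aemeasurable.aestronglyMeasurable (hlaw q).aemeasurable.aestronglyMeasurable
  rw [h, integral_eq_zero_of_hasLaw_gaussianReal (hlaw p), zero_mul]

lemma integral_sq_sub_mul_sq_sub_eq_zero [IsProbabilityMeasure P]
    (hind : iIndepFun g P)
    (hlaw : ∀ a, HasLaw (g a) (gaussianReal 0 1) P) {p q : κ} (hq : p ≠ q) :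
    ∫ ω, (g p ω * g p ω - 1) * (g q ω * g q ω - 1) ∂P = 0 := by
  have hI : IndepFun (fun ω => g p ω * g p ω - 1) (fun ω => g q ω * g q ω - 1) P :=
    (hind.indepFun hq).comp (φ := fun x => x * x - 1) (ψ := fun x => x * x - 1)
      (by fun_prop) (by fun_prop)
  have hm : ∀ a, AEMeasurable (fun ω => g a ω * g a ω - 1) P := fun a =>
    ((hlaw a).aemeasurable.mul (hlaw a).aemeasurable).sub aemeasurable_const
  rw [hI.integral_fun_mul_eq_mul_integral (hm p).aestronglyMeasurable
    (hm q).aestronglyMeasurable]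
  have h0 : ∫ ω, (g p ω * g p ω - 1) ∂P = 0 := by
    simp_rw [← sq]
    rw [integral_sub (integrable_pow_of_hasLaw_gaussianReal (hlaw p) 2) (integrable_const 1),
      integral_sq_of_hasLaw_gaussianReal (hlaw p)]
    simp
  rw [h0, zero_mul]

/-- Markov for the fourth moment: the second would be too weak for the union over all `n * m`
entries at the threshold used later. -/
lemma measureReal_le_abs_of_hasLaw_gaussianReal [IsProbabilityMeasure P]
    {X : Ω → ℝ}
    (hX : HasLaw X (gaussianReal 0 1) P) {t : ℝ} (ht : 0 < t) :
    P.real {ω | t ≤ |X ω|} ≤ (∫ x, x ^ 4 ∂gaussianReal 0 1) / t ^ 4 := by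
  have hM := mul_meas_ge_le_integral_of_nonneg (μ := P) (f := fun ω => X ω ^ 4)
    (.of_forall fun ω => by positivity) (integrable_pow_of_hasLaw_gaussianReal hX 4) (t ^ 4)
  have hset : {ω | t ^ 4 ≤ X ω ^ 4} = {ω | t ≤ |X ω|} := by
    ext ω
    simp only [Set.mem_ofPred_eq]
    rw [← (show Even 4 by decide).pow_abs (X ω),
      pow_le_pow_iff_left₀ ht.le (abs_nonneg _) four_ne_zero]
  rw [hset, integral_pow_of_hasLaw_gaussianReal hX] at hM
  rwa [le_div_iff₀ (by positivity), mul_comm]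

/-- Chebyshev's inequality for signed column sums of a matrix of standard Gaussian entries,
independent along each column. -/
lemma measureReal_le_abs_sum_mul_le {n m : ℕ} (hind : iIndepFun g P)
    (hlaw : ∀ a, HasLaw (g a) (gaussianReal 0 1) P) (idx : Fin n → Fin m → κ)
    (hinj : ∀ i j i' j', idx i j = idx i' j' ↔ (i : ℕ) + j = i' + j')
    (e : Fin n → ℝ) (j : Fin m) {t : ℝ} (ht : 0 < t) :
    P.real {ω | t ≤ |∑ i, (SignType.sign (e i) : ℝ) * g (idx i j) ω|} ≤ n / t ^ 2 := by
  have hs : ∀ i, (SignType.sign (e i) : ℝ) ^ 2 ≤ 1 := by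
    intro i
    rcases lt_trichotomy (e i) 0 with h | h | h <;> simp [h, sign_neg, sign_pos]
  have := measureReal_le_abs_sum_le (P := P) Finset.univ
    (fun i ω => (SignType.sign (e i) : ℝ) * g (idx i j) ω) (C := 1) ht
    (fun i _ => (memLp_of_hasLaw_gaussianReal (hlaw _) 2).const_mul _) ?_ ?_
  · simpa using this
  · intro i _ i' _ hii
    have hne : idx i j ≠ idx i' j := by
      rw [Ne, hinj]; have := Fin.val_ne_of_ne hii; omega
    simp only [mul_mul_mul_comm _ (g (idx i j) _)]
    rw [integral_const_mul, integral_mul_eq_zero hind hlaw hne, mul_zero]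
  · intro i _
    simp_rw [mul_pow]
    rw [integral_const_mul, integral_sq_of_hasLaw_gaussianReal (hlaw _), mul_one]
    exact hs i

/-- Chebyshev's inequality for the Gram entries of a Gaussian Toeplitz matrix. -/
lemma measureReal_le_abs_gram_le [IsProbabilityMeasure P]
    {n m : ℕ} (hind : iIndepFun g P)
    (hlaw : ∀ a, HasLaw (g a) (gaussianReal 0 1) P) (idx : Fin n → Fin m → κ)
    (hinj : ∀ i j i' j', idx i j = idx i' j' ↔ (i : ℕ) + j = i' + j')
    (s : Finset (Fin n)) (j k : Fin m) {t : ℝ} (ht : 0 < t) :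
    P.real {ω | t ≤ |∑ i ∈ s, (g (idx i j) ω * g (idx i k) ω - if j = k then 1 else 0)|}
      ≤ n * (2 * (∫ x, x ^ 4 ∂gaussianReal 0 1) + 2) / t ^ 2 := by
  have hM : 0 ≤ ∫ x : ℝ, x ^ 4 ∂gaussianReal 0 1 := integral_nonneg fun x => by positivity
  have := measureReal_le_abs_sum_le (P := P) s
    (fun i ω => g (idx i j) ω * g (idx i k) ω - if j = k then 1 else 0) ht
    (fun i _ => (memLp_mul_of_hasLaw_gaussianReal (hlaw _) (hlaw _)).sub (memLp_const _)) ?_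
    (fun i _ => integral_mul_sub_sq_le (hlaw _) (hlaw _) (by split_ifs <;> norm_num))
  · refine this.trans ?_
    gcongr
    simpa using s.card_le_univ
  · intro i _ i' _ hii
    have hii' := Fin.val_ne_of_ne hii
    by_cases hjk : j = k
    · subst hjk
      simp only [if_true]
      exact integral_sq_sub_mul_sq_sub_eq_zero hind hlaw (by rw [Ne, hinj]; omega)
    · have hjk' := Fin.val_ne_of_ne hjk
      simp only [hjk, if_false, sub_zero]
      -- It suffices that one of the four indices occurs once: `i + j = i' + k` and `i + k = i' + j`
      -- together would force `j = k`.
      have main : ∀ {a b c d : κ}, a ≠ b → a ≠ c → a ≠ d →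
          ∫ ω, g a ω * g b ω * (g c ω * g d ω) ∂P = 0 :=
        fun h1 h2 h3 => integral_mul_mul_eq_zero hind hlaw h1 h2 h3
      by_cases hc : (i : ℕ) + j = i' + k
      · -- then the index `i + k` occurs only once
        simp_rw [mul_comm (g (idx i j) _) (g (idx i k) _)]
        apply main <;> rw [Ne, hinj] <;> omega
      · apply main <;> rw [Ne, hinj] <;> omega

/-- Quantitative form of `ℓ₁` recovery for a Gaussian Toeplitz matrix. -/
lemma measureReal_not_isUniqueL1Minimizer_le [IsProbabilityMeasure P]
    {n m : ℕ} (hind : iIndepFun g P)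
    (hlaw : ∀ a, HasLaw (g a) (gaussianReal 0 1) P) (idx : Fin n → Fin m → κ)
    (hinj : ∀ i j i' j', idx i j = idx i' j' ↔ (i : ℕ) + j = i' + j')
    (e : Fin n → ℝ) {r ε : ℝ} (hr : 1 ≤ r) (hε : 0 < ε) (hn : (n : ℝ) = r ^ 16)
    (hlt : m * r ^ 15 + m * (ε * r ^ 16) < (Finset.univ.filter fun i => e i = 0).card) :
    P.real {ω | ¬ ∀ x : Fin m → ℝ, IsUniqueL1Minimizer
        (Matrix.of fun i j => g (idx i j) ω)
        ((Matrix.of fun i j => g (idx i j) ω).mulVec x + e) x}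
      ≤ (m + m * (∫ x, x ^ 4 ∂gaussianReal 0 1)
          + m * m * ((2 * (∫ x, x ^ 4 ∂gaussianReal 0 1) + 2) / ε ^ 2)) / r ^ 2 := by
  set M := ∫ x : ℝ, x ^ 4 ∂gaussianReal 0 1 with hMdef
  have hM : 0 ≤ M := integral_nonneg fun x => by positivity
  have hr0 : 0 < r := by linarith
  -- With `n = r^16`, the threshold `r^9` exceeds `√n = r^8` and `r^6` exceeds `n^(1/4) = r^4`, yet
  -- their product `r^15` is still `o(n)`.
  have hA : ∀ j : Fin m,
      P.real {ω | r ^ 9 ≤ |∑ i, (SignType.sign (e i) : ℝ) * g (idx i j) ω|} ≤ 1 / r ^ 2 := by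
    intro j
    refine (measureReal_le_abs_sum_mul_le hind hlaw idx hinj e j (by positivity)).trans_eq ?_
    rw [hn]; field_simp
  have hB : ∀ (i : Fin n) (j : Fin m),
      P.real {ω | r ^ 6 ≤ |g (idx i j) ω|} ≤ M / r ^ 24 := by
    intro i j
    refine (measureReal_le_abs_of_hasLaw_gaussianReal (hlaw _) (by positivity)).trans_eq ?_
    rw [← pow_mul]
  have hC : ∀ j k : Fin m, P.real {ω | ε * r ^ 16 ≤
      |∑ i with e i = 0, (g (idx i j) ω * g (idx i k) ω - if j = k then 1 else 0)|}
      ≤ (2 * M + 2) / ε ^ 2 / r ^ 16 := by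
    intro j k
    refine (measureReal_le_abs_gram_le hind hlaw idx hinj _ j k (by positivity)).trans_eq ?_
    rw [hn, ← hMdef]; field_simp
  set SA := ⋃ j : Fin m, {ω | r ^ 9 ≤ |∑ i, (SignType.sign (e i) : ℝ) * g (idx i j) ω|}
  set SB := ⋃ i : Fin n, ⋃ j : Fin m, {ω | r ^ 6 ≤ |g (idx i j) ω|}
  set SC := ⋃ j : Fin m, ⋃ k : Fin m, {ω | ε * r ^ 16 ≤
      |∑ i with e i = 0, (g (idx i j) ω * g (idx i k) ω - if j = k then 1 else 0)|}
  have hSA : P.real SA ≤ m * (1 / r ^ 2) := by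
    refine (measureReal_iUnion_fintype_le _).trans ?_
    refine (Finset.sum_le_card_nsmul _ _ _ fun j _ => hA j).trans_eq (by simp)
  have hSB : P.real SB ≤ n * (m * (M / r ^ 24)) := by
    refine (measureReal_iUnion_fintype_le _).trans ?_
    refine (Finset.sum_le_card_nsmul _ _ _ fun i _ => (measureReal_iUnion_fintype_le _).trans
      (Finset.sum_le_card_nsmul _ _ _ fun j _ => hB i j)).trans_eq (by simp)
  have hSC : P.real SC ≤ m * (m * ((2 * M + 2) / ε ^ 2 / r ^ 16)) := by
    refine (measureReal_iUnion_fintype_le _).trans ?_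
    refine (Finset.sum_le_card_nsmul _ _ _ fun i _ => (measureReal_iUnion_fintype_le _).trans
      (Finset.sum_le_card_nsmul _ _ _ fun j _ => hC i j)).trans_eq (by simp)
  have hsub : {ω | ¬ ∀ x : Fin m → ℝ, IsUniqueL1Minimizer
        (Matrix.of fun i j => g (idx i j) ω)
        ((Matrix.of fun i j => g (idx i j) ω).mulVec x + e) x} ⊆ SA ∪ SB ∪ SC := by
    intro ω hω
    by_contra hbad
    simp only [SA, SB, SC, Set.mem_union, Set.mem_iUnion, Set.mem_ofPred_eq, not_or, not_exists,
      not_le] at hbad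
    obtain ⟨⟨h1, h2⟩, h3⟩ := hbad
    refine hω fun x => isUniqueL1Minimizer_of_gram _ e (N := r ^ 9) (B := r ^ 6)
      (δ := ε * r ^ 16) (by positivity) (fun j => (h1 j).le) (fun i j => (h2 i j).le)
      (fun j k => (h3 j k).le) ?_ x
    refine lt_of_eq_of_lt ?_ hlt
    ring
  have hp : ∀ k, r ^ 2 ≤ r ^ (2 + k) := fun k => pow_le_pow_right₀ hr (by omega)
  calc _ ≤ P.real (SA ∪ SB ∪ SC) := measureReal_mono hsub
    _ ≤ P.real SA + P.real SB + P.real SC := (measureReal_union_le _ _).trans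
        (add_le_add_left (measureReal_union_le _ _) _)
    _ ≤ m * (1 / r ^ 2) + n * (m * (M / r ^ 24)) + m * (m * ((2 * M + 2) / ε ^ 2 / r ^ 16)) :=
        add_le_add (add_le_add hSA hSB) hSC
    _ ≤ m * (1 / r ^ 2) + m * (M / r ^ 2) + m * (m * ((2 * M + 2) / ε ^ 2 / r ^ 2)) := by
        have e1 : (n : ℝ) * (m * (M / r ^ 24)) = m * (M / r ^ 8) := by rw [hn]; field_simp
        rw [e1]
        have h8 := hp 6
        have h16 := hp 14
        norm_num only at h8 h16
        gcongr _ + _ * (M / ?_) + _ * (_ * (_ / ?_))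
    _ = _ := by field_simp

end Tail

/-! ### Passage to the limit -/

lemma card_filter_eq_zero_ge {n : ℕ} (e : Fin n → ℝ) {β : ℝ}
    (he : (numNonzero e : ℝ) ≤ β * n) :
    (1 - β) * n ≤ (Finset.univ.filter fun i => e i = 0).card := by
  have h1 : numNonzero e = (Finset.univ.filter fun i => ¬ e i = 0).card := by
    rw [numNonzero, ← Set.ncard_coe_finset]
    congr 1
    ext i
    simp
  have h2 := Finset.card_filter_add_card_filter_not (s := Finset.univ) (fun i : Fin n => e i = 0)
  rw [← h1, Finset.card_univ, Fintype.card_fin] at h2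
  have h3 : ((Finset.univ.filter fun i => e i = 0).card : ℝ) + numNonzero e = n := by
    exact_mod_cast h2
  linarith

theorem theorem3 (m : ℕ) (hm : 0 < m) (β : ℝ) (hβ0 : 0 < β) (hβ1 : β < 1)
    {Ω : ℕ → Type*} [∀ n, MeasurableSpace (Ω n)]
    (P : ∀ n, Measure (Ω n)) [∀ n, IsProbabilityMeasure (P n)]
    (h : ∀ n, ℤ → Ω n → ℝ)
    (hlaw : ∀ n : ℕ, ∀ i ∈ Set.Icc (-(m : ℤ) + 2) (n : ℤ),
      HasLaw (h n i) (gaussianReal 0 1) (P n))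
    (hindep : ∀ n : ℕ,
      iIndepFun (fun i : Set.Icc (-(m : ℤ) + 2) (n : ℤ) => h n (i : ℤ)) (P n))
    (e : ∀ n : ℕ, Fin n → ℝ)
    (he : ∀ n : ℕ, (numNonzero (e n) : ℝ) ≤ β * (n : ℝ)) :
    Tendsto
      (fun n : ℕ => P n {ω | ∀ x : Fin m → ℝ,
        IsUniqueL1Minimizer (toeplitzMatrix n m (fun i => h n i ω))
          ((toeplitzMatrix n m (fun i => h n i ω)).mulVec x + e n) x})
      atTop (𝓝 1) := by
  set S : ∀ n, Set (Ω n) := fun n => {ω | ∀ x : Fin m → ℝ,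
        IsUniqueL1Minimizer (toeplitzMatrix n m (fun i => h n i ω))
          ((toeplitzMatrix n m (fun i => h n i ω)).mulVec x + e n) x} with hS
  have hm0 : (0 : ℝ) < m := by exact_mod_cast hm
  have hβ : 0 < 1 - β := by linarith
  -- Makes the Gram error `m * ε * n` exactly half of `(1 - β) * n`; the other half absorbs `m *
  -- r^15` once `r > 2m / (1 - β)`.
  set ε : ℝ := (1 - β) / (2 * m) with hεd
  have hε : 0 < ε := by positivity
  set K : ℝ := m + m * (∫ x, x ^ 4 ∂gaussianReal 0 1)
          + m * m * ((2 * (∫ x, x ^ 4 ∂gaussianReal 0 1) + 2) / ε ^ 2)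
  set r : ℕ → ℝ := fun n => (n : ℝ) ^ ((1 : ℝ) / 16) with hrd
  have hr : Tendsto r atTop atTop :=
    (tendsto_rpow_atTop (by norm_num)).comp tendsto_natCast_atTop_atTop
  have hbound : ∀ᶠ n in atTop, (P n).real (S n)ᶜ ≤ K / r n ^ 2 := by
    filter_upwards [hr.eventually_ge_atTop 1, hr.eventually_gt_atTop (2 * m / (1 - β))]
      with n hn1 hn2
    have hrn : (n : ℝ) = r n ^ 16 := by
      rw [hrd, ← Real.rpow_natCast, ← Real.rpow_mul (Nat.cast_nonneg n)]
      norm_num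
    have hmem : ∀ (i : Fin n) (j : Fin m), -(m : ℤ) + 2 + ((i : ℕ) : ℤ) + ((j : ℕ) : ℤ) ∈
        Set.Icc (-(m : ℤ) + 2) (n : ℤ) := by
      intro i j
      have := i.2
      have := j.2
      constructor <;> omega
    refine measureReal_not_isUniqueL1Minimizer_le (hindep n) (fun a => hlaw n a a.2)
      (fun i j => ⟨_, hmem i j⟩) ?_ (e n) hn1 hε hrn ?_
    · intro i j i' j'
      rw [Subtype.mk.injEq]
      omega
    · refine lt_of_lt_of_le ?_ (card_filter_eq_zero_ge (e n) (he n))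
      rw [div_lt_iff₀ hβ] at hn2
      have e1 : (m : ℝ) * (ε * r n ^ 16) = (1 - β) / 2 * r n ^ 16 := by
        rw [hεd]; field_simp
      have h15 : 0 < r n ^ 15 := by positivity
      rw [e1, hrn]
      nlinarith [mul_lt_mul_of_pos_right hn2 h15]
  have hlim : Tendsto (fun n => 1 - ENNReal.ofReal (K / r n ^ 2)) atTop (𝓝 1) := by
    have h0 : Tendsto (fun n => K / r n ^ 2) atTop (𝓝 0) :=
      tendsto_const_nhds.div_atTop ((tendsto_pow_atTop two_ne_zero).comp hr)
    have h1 := ENNReal.Tendsto.sub (tendsto_const_nhds (x := (1 : ENNReal)))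
      (ENNReal.tendsto_ofReal h0) (Or.inl ENNReal.one_ne_top)
    simpa using h1
  refine tendsto_of_tendsto_of_tendsto_of_le_of_le' hlim tendsto_const_nhds ?_
    (.of_forall fun n => prob_le_one)
  filter_upwards [hbound] with n hn
  -- Subadditivity avoids any measurability claim about `S n`.
  have h1 : 1 ≤ P n (S n) + P n (S n)ᶜ := by
    rw [← measure_univ (μ := P n), ← Set.union_compl_self (S n)]
    exact measure_union_le _ _
  rw [tsub_le_iff_right]
  refine h1.trans (add_le_add_right ?_ _)
  rw [← ofReal_measureReal]
  exact ENNReal.ofReal_le_ofReal hn
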